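/- Let $\varphi = (1+\sqrt5)/2$. The Hurt--Sada array $(A[n,k])_{n,k\ge 0}$ is defined as follows. Row $0$ is $0,1,2,3,\ldots$, that is, $A[0,k]=k$ for all $k \ge 0$. For $n\ge 1$, row $n$ is obtained from row $n-1$ by taking the unique occurrence of $n$ in row $n-1$ and shifting it by $n$ positions to the right, so that each of the $n$ entries it jumps over moves one position to the left and all other entries stay in place. Each row is a permutation of the natural numbers. For $n\ge 1$, let $b(n)$ be the largest integer $b \ge 0$ such that $A[n,i]=i$ for all $0\le i\le b$, and let $c(n)$ be the smallest integer $c \ge 0$ such that $A[n,i]=i$ for all $i\ge c$. Then for every $n\ge 1$ both $b(n)$ and $c(n)$ exist, and $$b(n)=\left\lfloor \frac{n+2}{\varphi}\right\rfloor-1,\qquad c(n)=\lfloor (n+1)\varphi\rfloor .$$ Moreover, in row $n$ the entries in columns $b(n)+1,\ldots,c(n)-1$ form a permutation of the numbers $b(n)+1,\ldots,c(n)-1$, and this permutation leaves no element fixed: $A[n,i]\neq i$ for $b(n)+1\le i\le c(n)-1$. -/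

import Mathlib

/-- The sequence obtained from `r` by shifting the entry in position `p` by `k` positions to the
right; the `k` entries that it jumps over each move one position to the left. -/
def shiftEntry (r : ℕ → ℕ) (p k : ℕ) : ℕ → ℕ := fun j =>
  if j < p then r j
  else if j < p + k then r (j + 1)
  else if j = p + k then r p
  else r j

/-- The Hurt-Sada array: `hurtSada n j` is the entry in row `n` and column `j`. Row `0` is
`0, 1, 2, …`, and row `n + 1` arises from row `n` by shifting the occurrence of `n + 1` in row `n`
by `n + 1` positions to the right. This occurrence exists and is unique, see
`hurtSada_existsUnique_position`, so that the infimum is its position. -/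
noncomputable def hurtSada : ℕ → ℕ → ℕ
  | 0 => fun j => j
  | n + 1 => shiftEntry (hurtSada n) (sInf {i | hurtSada n i = n + 1}) (n + 1)

theorem shiftEntry_bijective {r : ℕ → ℕ} (hr : Function.Bijective r) (p k : ℕ) :
    Function.Bijective (shiftEntry r p k) := by
  have key : shiftEntry r p k = r ∘ shiftEntry id p k := by
    funext j
    simp only [shiftEntry, Function.comp, id]
    split_ifs <;> rfl
  rw [key]
  refine hr.comp ⟨fun a b h => ?_, fun y => ?_⟩
  · simp only [shiftEntry, id] at h
    split_ifs at h <;> omega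
  · by_cases h1 : y < p
    · exact ⟨y, by simp [shiftEntry, h1]⟩
    by_cases h2 : y = p
    · exact ⟨p + k, by simp [shiftEntry, h2]⟩
    by_cases h3 : y ≤ p + k
    · refine ⟨y - 1, ?_⟩
      simp only [shiftEntry, id]
      split_ifs <;> omega
    · refine ⟨y, ?_⟩
      simp only [shiftEntry, id]
      split_ifs <;> omega

/-- Each row of the array is a permutation of the natural numbers. -/
theorem hurtSada_bijective (n : ℕ) : Function.Bijective (hurtSada n) := by
  induction n with
  | zero => exact Function.bijective_id
  | succ n ih => exact shiftEntry_bijective ih _ _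

/-- Each natural number `m` occurs exactly once in each row. -/
theorem hurtSada_existsUnique_position (n m : ℕ) : ∃! i, hurtSada n i = m :=
  (hurtSada_bijective n).existsUnique m

/-! Write g for `goldenFloor`. The life of each m ≥ 1 is explicit: it rests in column m, drifts left
one column per row from row g(m) on, is in column g(m) when its turn comes in row m, jumps to g(m) +
m, and drifts left again until it is back in column m in row g(m) + m, for good. So m is displaced
in row n exactly when g(m) ≤ n < g(m) + m, which `goldenFloor_le_iff` turns into g(n+1) ≤ m ≤ g(n) +
n. -/

/-- The sequence `⌊(n + 1) / φ⌋`. -/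
noncomputable def goldenFloor (n : ℕ) : ℕ := ⌊((n : ℝ) + 1) / Real.goldenRatio⌋₊

theorem div_goldenRatio_eq (x : ℝ) : x / Real.goldenRatio = x * Real.goldenRatio - x := by
  rw [div_eq_iff Real.goldenRatio_ne_zero]
  linear_combination (-x) * Real.goldenRatio_sq

theorem goldenFloor_cast_floor (n : ℕ) :
    (goldenFloor n : ℤ) = ⌊((n : ℝ) + 1) / Real.goldenRatio⌋ :=
  Int.natCast_floor_eq_floor (div_nonneg (by positivity) Real.goldenRatio_pos.le)

theorem goldenFloor_add_cast_floor (n : ℕ) :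
    (goldenFloor n : ℤ) + n + 1 = ⌊((n : ℝ) + 1) * Real.goldenRatio⌋ := by
  have h : ((n : ℝ) + 1) * Real.goldenRatio =
      ((n : ℝ) + 1) / Real.goldenRatio + ((n + 1 : ℕ) : ℝ) := by
    rw [div_goldenRatio_eq]; push_cast; ring
  rw [h, Int.floor_add_natCast, goldenFloor_cast_floor]
  push_cast; ring

/-- Since φ = 1 + 1/φ, both sides compare n + 1 with (m + 1)φ, strictly and weakly; irrationality of
φ rules out equality. With monotonicity, this is all that the later case analyses need to know about
φ. -/
theorem goldenFloor_le_iff (n m : ℕ) : goldenFloor n ≤ m ↔ n ≤ goldenFloor m + m := by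
  have hirr : ((m : ℝ) + 1) * Real.goldenRatio ≠ (n : ℝ) + 1 := by
    have := (Real.goldenRatio_irrational.natCast_mul (Nat.succ_ne_zero m)).ne_nat (n + 1)
    push_cast at this
    exact this
  have h1 : goldenFloor n ≤ m ↔ (n : ℝ) + 1 < ((m : ℝ) + 1) * Real.goldenRatio := by
    rw [← Nat.lt_succ_iff, goldenFloor, Nat.floor_lt
      (div_nonneg (by positivity) Real.goldenRatio_pos.le), div_lt_iff₀ Real.goldenRatio_pos]
    push_cast
    rfl
  have h2 : n ≤ goldenFloor m + m ↔ (n : ℝ) + 1 ≤ ((m : ℝ) + 1) * Real.goldenRatio := by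
    have h : ((n : ℤ) + 1 ≤ (goldenFloor m : ℤ) + m + 1) ↔ n ≤ goldenFloor m + m := by omega
    rw [← h, goldenFloor_add_cast_floor, Int.le_floor]
    push_cast
    rfl
  rw [h1, h2]
  exact ⟨le_of_lt, fun h => lt_of_le_of_ne h hirr.symm⟩

theorem goldenFloor_mono : Monotone goldenFloor := fun n n' h =>
  (goldenFloor_le_iff n _).2 (h.trans ((goldenFloor_le_iff n' _).1 le_rfl))

theorem goldenFloor_pos {n : ℕ} (hn : 1 ≤ n) : 1 ≤ goldenFloor n := by
  have h0 := (goldenFloor_le_iff 0 0).2 (Nat.zero_le _)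
  have h1 := (goldenFloor_le_iff 1 0).not
  have := goldenFloor_mono hn
  omega

/-- The position of the number `m` in row `n` of the Hurt-Sada array, in closed form. -/
noncomputable def hurtSadaPosition (n m : ℕ) : ℕ :=
  if m < goldenFloor (n + 1) then m
  else if m ≤ n then goldenFloor m + 2 * m - n
  else if m ≤ goldenFloor n + n then m + goldenFloor m - n - 1
  else m

/-- The inner conditional is the column to which the shift sends the entry of column q. -/
theorem shiftEntry_shifted_position (r : ℕ → ℕ) (p k q : ℕ) :
    shiftEntry r p k (if q < p then q else if q = p then p + k
      else if q ≤ p + k then q - 1 else q) = r q := by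
  unfold shiftEntry
  by_cases h1 : q < p
  · simp [h1]
  by_cases h2 : q = p
  · simp [h2]
  by_cases h3 : q ≤ p + k
  · have e : q - 1 + 1 = q := by omega
    rw [if_neg h1, if_neg h2, if_pos h3, if_neg (by omega), if_pos (by omega), e]
  · rw [if_neg h1, if_neg h2, if_neg h3, if_neg h1, if_neg (by omega), if_neg (by omega)]

theorem hurtSadaPosition_next (n : ℕ) : hurtSadaPosition n (n + 1) = goldenFloor (n + 1) := by
  have h1 := goldenFloor_le_iff (n + 1) (n + 1)
  have h2 := goldenFloor_le_iff (n + 1) n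
  have h3 := goldenFloor_pos (n := n + 1) (by omega)
  unfold hurtSadaPosition
  split_ifs
  · omega
  · omega
  · omega
  · obtain rfl | hn := Nat.eq_zero_or_pos n
    · omega
    · have := goldenFloor_pos hn
      omega

theorem hurtSadaPosition_succ (n m : ℕ) :
    hurtSadaPosition (n + 1) m =
      if hurtSadaPosition n m < goldenFloor (n + 1) then hurtSadaPosition n m
      else if hurtSadaPosition n m = goldenFloor (n + 1) then goldenFloor (n + 1) + (n + 1)
      else if hurtSadaPosition n m ≤ goldenFloor (n + 1) + (n + 1) then hurtSadaPosition n m - 1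
      else hurtSadaPosition n m := by
  have hp := goldenFloor_pos (n := n + 1) (by omega)
  have hs := goldenFloor_mono (Nat.le_succ (n + 1))
  have hs0 := goldenFloor_mono (Nat.le_succ n)
  have g1 := goldenFloor_le_iff (n + 1) m
  have g2 := goldenFloor_le_iff (n + 1 + 1) m
  have g3 := goldenFloor_le_iff m n
  have g4 := goldenFloor_le_iff m (n + 1)
  have g5 := goldenFloor_le_iff (n + 1 + 1) (n + 1)
  simp only [Nat.succ_eq_add_one] at hs hs0
  rcases lt_trichotomy m (n + 1) with h | rfl | h
  · have hm := goldenFloor_mono h.le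
    unfold hurtSadaPosition
    split_ifs <;> omega
  · rw [hurtSadaPosition_next, if_neg (lt_irrefl _), if_pos rfl]
    unfold hurtSadaPosition
    rw [if_neg (by omega), if_pos le_rfl]
    omega
  · have hm := goldenFloor_mono h.le
    have g6 := goldenFloor_le_iff (n + 1) (n + 1)
    unfold hurtSadaPosition
    split_ifs <;> omega

theorem hurtSada_position (n m : ℕ) : hurtSada n (hurtSadaPosition n m) = m := by
  induction n generalizing m with
  | zero =>
    have h0 := (goldenFloor_le_iff 0 0).2 (Nat.zero_le _)
    have h1 := goldenFloor_pos (n := 1) le_rfl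
    change hurtSadaPosition 0 m = m
    unfold hurtSadaPosition
    simp only [zero_add]
    split_ifs <;> omega
  | succ n ih =>
    have hset : {i | hurtSada n i = n + 1} = {goldenFloor (n + 1)} := by
      ext i
      rw [Set.mem_ofPred_eq, Set.mem_singleton_iff, ← hurtSadaPosition_next]
      refine ⟨fun h => (hurtSada_bijective n).1 (h.trans (ih _).symm), ?_⟩
      rintro rfl
      exact ih _
    change shiftEntry (hurtSada n) (sInf {i | hurtSada n i = n + 1}) (n + 1) _ = m
    rw [hset, csInf_singleton, hurtSadaPosition_succ, shiftEntry_shifted_position, ih]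

theorem hurtSada_eq_self_iff {n : ℕ} (i : ℕ) :
    hurtSada n i = i ↔ i < goldenFloor (n + 1) ∨ goldenFloor n + n < i := by
  have h : hurtSada n i = i ↔ hurtSadaPosition n i = i := by
    refine ⟨fun h => (hurtSada_bijective n).1 ((hurtSada_position n i).trans h.symm), fun h => ?_⟩
    have := hurtSada_position n i
    rwa [h] at this
  have g1 := goldenFloor_le_iff (n + 1) i
  have g2 := goldenFloor_le_iff i n
  have g3 := goldenFloor_le_iff (n + 1) (n + 1)
  rw [h]
  unfold hurtSadaPosition
  split_ifs <;> omega

theorem Function.Bijective.bijOn_setOf_ne {α : Type*} {f : α → α} (hf : Function.Bijective f) :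
    Set.BijOn f {x | f x ≠ x} {x | f x ≠ x} := by
  refine ⟨fun x hx h => hx (hf.1 h), hf.1.injOn, fun y hy => ?_⟩
  obtain ⟨x, rfl⟩ := hf.2 y
  exact ⟨x, fun h => hy (congrArg f h), rfl⟩

theorem theorem10 (n : ℕ) (hn : 1 ≤ n) :
    ∃ b c : ℕ,
      IsGreatest {k : ℕ | ∀ i ≤ k, hurtSada n i = i} b ∧
      IsLeast {k : ℕ | ∀ i ≥ k, hurtSada n i = i} c ∧
      (b : ℤ) = ⌊((n : ℝ) + 2) / Real.goldenRatio⌋ - 1 ∧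
      (c : ℤ) = ⌊((n : ℝ) + 1) * Real.goldenRatio⌋ ∧
      Set.BijOn (hurtSada n) (Set.Icc (b + 1) (c - 1)) (Set.Icc (b + 1) (c - 1)) ∧
      ∀ i ∈ Set.Icc (b + 1) (c - 1), hurtSada n i ≠ i := by
  have hpos := goldenFloor_pos hn
  have hpos' := goldenFloor_pos (n := n + 1) (by omega)
  -- This makes the window nonempty, so its two end columns witness that b and c are extremal; it
  -- fails for n = 0, where every column is fixed.
  have hle := (goldenFloor_le_iff (n + 1) n).2 (by omega)
  have hwindow : Set.Icc (goldenFloor (n + 1) - 1 + 1) (goldenFloor n + n + 1 - 1) =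
      {i | hurtSada n i ≠ i} := by
    ext i
    rw [Set.mem_Icc, Set.mem_ofPred_eq, Ne, hurtSada_eq_self_iff]
    omega
  refine ⟨goldenFloor (n + 1) - 1, goldenFloor n + n + 1, ⟨fun i hi => ?_, fun k hk => ?_⟩,
    ⟨fun i hi => ?_, fun k hk => ?_⟩, ?_, ?_, ?_, ?_⟩
  · rw [hurtSada_eq_self_iff]
    omega
  · by_contra h
    have := (hurtSada_eq_self_iff _).1 (hk (goldenFloor (n + 1)) (by omega))
    omega
  · rw [hurtSada_eq_self_iff]
    omega
  · by_contra h
    have := (hurtSada_eq_self_iff _).1 (hk (goldenFloor n + n) (by omega))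
    omega
  · have h := goldenFloor_cast_floor (n + 1)
    have e : (((n + 1 : ℕ) : ℝ) + 1) = (n : ℝ) + 2 := by push_cast; ring
    rw [e] at h
    rw [← h]
    omega
  · rw [← goldenFloor_add_cast_floor]
    push_cast
    rfl
  · rw [hwindow]
    -- Any bijection permutes the set of its non-fixed points.
    exact (hurtSada_bijective n).bijOn_setOf_ne
  · intro i hi
    rw [hwindow] at hi
    exact hi
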